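/- **Setting.** Let $\mathcal A$ be a finite alphabet with a distinguished letter $1$, and let $\varphi$ be a substitution on $\mathcal A$ (each letter is sent to a finite nonempty word, and $\varphi$ is extended to words by concatenation). Assume $\varphi$ is primitive: for all sufficiently large $m$ and all letters $i,j$, the word $\varphi^m(i)$ contains $j$. Assume that $\varphi(1)$ begins with $1$. Let ${\bf u}=u_0u_1\ldots$ be the right infinite sequence with $u_0=1$ fixed by $\varphi$, and let $w$ be a nonempty prefix of ${\bf u}$. Let ${\bf p}(v)$ be the population vector of a word $v$ (the number of occurrences of each letter), $A_\varphi=(p_i(\varphi(j)))_{i,j}$ the transition matrix, $\lambda$ its Perron–Frobenius eigenvalue and ${\bf L}={\bf L}_\lambda$ a left eigenvector of $A_\varphi$ for $\lambda$ with positive entries $l_i$. Put $x=x(w)={\bf L}\cdot{\bf p}(w)$. **The algorithm $\mathrm{bpa}(w,{\bf L})$.** Write $v\sim_{\bf L}v'$ if ${\bf L}\cdot{\bf p}(\varphi^n(v))={\bf L}\cdot{\bf p}(\varphi^n(v'))$ for all $n\ge 0$. A pair $(v,v')$ of nonempty words is balanced if $v\sim_{\bf L}v'$, and a balanced pair is irreducible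 if it is not the concatenation of two balanced pairs. The reduction of a pair of finite words or of right infinite sequences is its decomposition into consecutive irreducible balanced pairs. Let $I_1$ be the set of irreducible balanced pairs in the reduction of $({\bf u},\sigma^{|w|}{\bf u})$, where $\sigma$ is the shift; let $I_{n+1}$ be the set of irreducible balanced pairs in the reductions of $(\varphi(v),\varphi(v'))$ for $(v,v')\in I_n$. The algorithm terminates if $\bigcup_{n\ge1}I_n$ is finite. **The overlap algorithm associated to $x$.** Let $T$ be the tiling of $[0,\infty)$ by closed intervals labelled $u_0,u_1,\ldots$, laid consecutively from $0$, where a tile labelled $i$ has length $l_i$. An overlap is a pair of labelled tiles whose interiors meet; two overlaps are equivalent if they are translates of each other. An overlap is a half-coincidence if its two tiles have a common left endpoint or a common right endpoint. Inflating a tile labelled $i$ means expanding it by the factor $\lambda$ and subdividing the result into tiles according to $\varphi(i)$; inflating an overlap $(s,t)$ yields all overlaps $(s',t')$ with $s'$ a tile of the inflated $s$ and $t'$ a tile of the inflated $t$. The algorithm starts with all overlaps $(s,t)$, $s\in T$, $t\in T-x$, and inflates repeatedly. It terminates with half-coincidences if only finitely many equivalence classes of overlaps are produced in total and, for each overlap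 produced, some iterated inflation of it contains a half-coincidence. **Proposition.** The overlap algorithm associated to $x=x(w)={\bf L}_\lambda\cdot{\bf p}(w)$ terminates with half-coincidences if and only if $\mathrm{bpa}(w,{\bf L}_\lambda)$ terminates. -/

import Mathlib

namespace BalancedPairs

/-- A substitution: every letter is sent to a finite nonempty word. -/
structure Substitution (A : Type*) where
  img : A → List A
  img_ne_nil : ∀ i, img i ≠ []

variable {A : Type*}

/-! ### Substitutions and words -/

/-- The extension of a substitution to finite words by concatenation. -/
def Substitution.onWord (φ : Substitution A) (w : List A) : List A := w.flatMap φ.img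

/-- `φ.iter n w` is the word `φⁿ(w)`. -/
def Substitution.iter (φ : Substitution A) (n : ℕ) (w : List A) : List A := φ.onWord^[n] w

/-- Primitivity: `φᵐ(i)` contains `j` for all letters `i`, `j` and all sufficiently large `m`. -/
def Substitution.IsPrimitive (φ : Substitution A) : Prop :=
  ∃ m₀ : ℕ, ∀ m ≥ m₀, ∀ i j : A, j ∈ φ.iter m [i]

/-- The prefix `u₀ ⋯ u_{N-1}` of a right infinite sequence. -/
def pre (u : ℕ → A) (N : ℕ) : List A := (List.range N).map u

/-- The finite word `w` is a prefix of the right infinite sequence `u`. -/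
def IsPrefixOf (w : List A) (u : ℕ → A) : Prop := w = pre u w.length

/-- The right infinite sequence `u` is fixed by `φ`. -/
def Substitution.Fixes (φ : Substitution A) (u : ℕ → A) : Prop :=
  ∀ N : ℕ, IsPrefixOf (φ.onWord (pre u N)) u

/-- The shifted sequence `σᵏ u`. -/
def shift (k : ℕ) (u : ℕ → A) : ℕ → A := fun n => u (n + k)

variable [DecidableEq A]

/-- The population vector `p(w)`. -/
def population (w : List A) : A → ℝ := fun i => (w.count i : ℝ)

/-- The transition matrix, with entries `a_{ij} = p_i(φ(j))`. -/
def Substitution.transitionMatrix (φ : Substitution A) : Matrix A A ℝ :=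
  Matrix.of fun i j => population (φ.img j) i

variable [Fintype A]

/-- The geometric length `L · p(w)` of the word `w`. -/
def wordLength (L : A → ℝ) (w : List A) : ℝ := dotProduct L (population w)

/-! ### The Perron-Frobenius eigenvalue and the self-similar length vector -/

/-- `lam` is an eigenvalue of the real matrix `M`, larger in modulus than all its remaining
(complex) eigenvalues. -/
def IsPerronFrobeniusEigenvalue (M : Matrix A A ℝ) (lam : ℝ) : Prop :=
  Module.End.HasEigenvalue (Matrix.toLin' M) lam ∧
    ∀ μ : ℂ, Module.End.HasEigenvalue (Matrix.toLin' (M.map Complex.ofReal)) μ →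
      μ ≠ (lam : ℂ) → ‖μ‖ < |lam|

/-- `L` is a length vector `L_λ`: its entries are positive and it is a left eigenvector of the
transition matrix for the Perron-Frobenius eigenvalue `lam`. (It is unique up to scaling.) -/
structure IsSelfSimilarLength (φ : Substitution A) (lam : ℝ) (L : A → ℝ) : Prop where
  perronFrobenius : IsPerronFrobeniusEigenvalue φ.transitionMatrix lam
  pos : ∀ i, 0 < L i
  eigenvector : Matrix.vecMul L φ.transitionMatrix = lam • L

/-! ### The generalized balanced pair algorithm `bpa(w, L)` -/

/-- The relation `v ∼_L w`: `L · p(φⁿ(v)) = L · p(φⁿ(w))` for all `n`. -/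
def WordEquiv (φ : Substitution A) (L : A → ℝ) (v w : List A) : Prop :=
  ∀ n : ℕ, wordLength L (φ.iter n v) = wordLength L (φ.iter n w)

/-- A balanced (equivalent) pair of nonempty words. -/
def IsBalanced (φ : Substitution A) (L : A → ℝ) (β : List A × List A) : Prop :=
  β.1 ≠ [] ∧ β.2 ≠ [] ∧ WordEquiv φ L β.1 β.2

/-- A balanced pair is irreducible if it is not the concatenation of two balanced pairs. -/
def IsIrreduciblePair (φ : Substitution A) (L : A → ℝ) (β : List A × List A) : Prop :=
  IsBalanced φ L β ∧
    ¬ ∃ γ δ : List A × List A, IsBalanced φ L γ ∧ IsBalanced φ L δ ∧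
      β.1 = γ.1 ++ δ.1 ∧ β.2 = γ.2 ++ δ.2

/-- The top word of a concatenation of pairs. -/
def topWord (l : List (List A × List A)) : List A := l.flatMap Prod.fst

/-- The bottom word of a concatenation of pairs. -/
def bottomWord (l : List (List A × List A)) : List A := l.flatMap Prod.snd

/-- The irreducible balanced pairs in the reduction of a pair of finite words, i.e. in its
decomposition as a concatenation of irreducible balanced pairs. -/
def reductionPairs (φ : Substitution A) (L : A → ℝ) (β : List A × List A) :
    Set (List A × List A) :=
  {γ | ∃ l : List (List A × List A), (∀ δ ∈ l, IsIrreduciblePair φ L δ) ∧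
    topWord l = β.1 ∧ bottomWord l = β.2 ∧ γ ∈ l}

/-- The irreducible balanced pairs in the reduction of a pair of right infinite sequences: those
occurring in some finite initial part of its decomposition into irreducible balanced pairs. -/
def infiniteReductionPairs (φ : Substitution A) (L : A → ℝ) (u v : ℕ → A) :
    Set (List A × List A) :=
  {γ | ∃ l : List (List A × List A), (∀ δ ∈ l, IsIrreduciblePair φ L δ) ∧
    IsPrefixOf (topWord l) u ∧ IsPrefixOf (bottomWord l) v ∧ γ ∈ l}

/-- `bpaStage φ L u w n` is `I_{n+1}(w, L)`: first the irreducible balanced pairs of `u` over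
`σ^{|w|} u`, then repeatedly substitution and reduction. -/
def bpaStage (φ : Substitution A) (L : A → ℝ) (u : ℕ → A) (w : List A) :
    ℕ → Set (List A × List A)
  | 0 => infiniteReductionPairs φ L u (shift w.length u)
  | n + 1 => {γ | ∃ β ∈ bpaStage φ L u w n,
      γ ∈ reductionPairs φ L (φ.onWord β.1, φ.onWord β.2)}

/-- `bpa(w, L)` terminates: `I(w, L) = ⋃ I_n(w, L)` is finite. -/
def BpaTerminates (φ : Substitution A) (L : A → ℝ) (u : ℕ → A) (w : List A) : Prop :=
  (⋃ n, bpaStage φ L u w n).Finite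

/-! ### The overlap algorithm -/

/-- A tile, given by its left endpoint and its label. -/
@[ext]
structure Tile (A : Type*) where
  pos : ℝ
  label : A

/-- The closed interval occupied by a tile. -/
def Tile.support {A : Type*} (L : A → ℝ) (t : Tile A) : Set ℝ :=
  Set.Icc t.pos (t.pos + L t.label)

/-- The right endpoint of a tile. -/
def Tile.rightEnd {A : Type*} (L : A → ℝ) (t : Tile A) : ℝ := t.pos + L t.label

/-- The translate `t + c`. -/
def Tile.translate {A : Type*} (c : ℝ) (t : Tile A) : Tile A := ⟨t.pos + c, t.label⟩

/-- The tiles of a word laid down consecutively to the right of the point `a`. -/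
def layTiles {A : Type*} (L : A → ℝ) : ℝ → List A → List (Tile A)
  | _, [] => []
  | a, i :: w => ⟨a, i⟩ :: layTiles L (a + L i) w

/-- The tiling `T` of the half-line `[0, ∞)` given by the right infinite sequence `u`. -/
def tiling (L : A → ℝ) (u : ℕ → A) : Set (Tile A) :=
  {t | ∃ k : ℕ, t = ⟨wordLength L (pre u k), u k⟩}

/-- The tile-substitution: the tile `t` is expanded by the factor `lam`, and the expanded
interval is subdivided according to `φ`. -/
def inflateTile {A : Type*} (φ : Substitution A) (lam : ℝ) (L : A → ℝ) (t : Tile A) :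
    List (Tile A) :=
  layTiles L (lam * t.pos) (φ.img t.label)

/-- The pair of tiles is an overlap: the interiors of the tiles meet. -/
def IsOverlap {A : Type*} (L : A → ℝ) (o : Tile A × Tile A) : Prop :=
  (interior (o.1.support L) ∩ interior (o.2.support L)).Nonempty

/-- The class of an overlap modulo translation: the two labels and the relative position. -/
def overlapType {A : Type*} (o : Tile A × Tile A) : A × A × ℝ :=
  (o.1.label, o.2.label, o.2.pos - o.1.pos)

/-- Two overlaps have the same type exactly when they are translates of each other. -/
theorem overlapType_eq_iff {A : Type*} (o o' : Tile A × Tile A) :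
    overlapType o = overlapType o' ↔
      ∃ c : ℝ, o' = (o.1.translate c, o.2.translate c) := by
  obtain ⟨⟨a, i⟩, ⟨b, j⟩⟩ := o
  obtain ⟨⟨a', i'⟩, ⟨b', j'⟩⟩ := o'
  simp only [overlapType, Tile.translate, Prod.mk.injEq, Tile.mk.injEq]
  constructor
  · rintro ⟨rfl, rfl, h⟩
    exact ⟨a' - a, ⟨by ring, rfl⟩, by linarith, rfl⟩
  · rintro ⟨c, ⟨rfl, rfl⟩, rfl, rfl⟩
    exact ⟨rfl, rfl, by ring⟩

/-- The two tiles have a common left endpoint or a common right endpoint. -/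
def IsHalfCoincidence {A : Type*} (L : A → ℝ) (o : Tile A × Tile A) : Prop :=
  o.1.pos = o.2.pos ∨ o.1.rightEnd L = o.2.rightEnd L

/-- All overlaps arising when the overlaps in `E` are inflated and subdivided once. -/
def inflateOverlaps {A : Type*} (φ : Substitution A) (lam : ℝ) (L : A → ℝ)
    (E : Set (Tile A × Tile A)) : Set (Tile A × Tile A) :=
  {o' | IsOverlap L o' ∧ ∃ o ∈ E,
    o'.1 ∈ inflateTile φ lam L o.1 ∧ o'.2 ∈ inflateTile φ lam L o.2}

/-- The overlaps of the pair of tilings `(T, T - x)`. -/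
def initialOverlaps (L : A → ℝ) (u : ℕ → A) (x : ℝ) : Set (Tile A × Tile A) :=
  {o | IsOverlap L o ∧ ∃ s ∈ tiling L u, ∃ t ∈ tiling L u, o = (s, t.translate (-x))}

/-- The overlaps produced by the overlap algorithm associated to `x`: those of `(T, T - x)` and
all those obtained from them by repeated inflation and subdivision. -/
def algorithmOverlaps (φ : Substitution A) (lam : ℝ) (L : A → ℝ) (u : ℕ → A) (x : ℝ) :
    Set (Tile A × Tile A) :=
  ⋃ n : ℕ, (inflateOverlaps φ lam L)^[n] (initialOverlaps L u x)

/-- Some iterated inflation of the overlap `o` contains a half-coincidence. -/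
def LeadsToHalfCoincidence {A : Type*} (φ : Substitution A) (lam : ℝ) (L : A → ℝ)
    (o : Tile A × Tile A) : Prop :=
  ∃ n : ℕ, ∃ o' ∈ (inflateOverlaps φ lam L)^[n] {o}, IsHalfCoincidence L o'

/-- The overlap algorithm associated to `x` terminates with half-coincidences: it produces only
finitely many overlaps modulo translation, and each of them leads to a half-coincidence. -/
def OverlapTerminatesWithHalfCoincidences (φ : Substitution A) (lam : ℝ) (L : A → ℝ)
    (u : ℕ → A) (x : ℝ) : Prop :=
  (overlapType '' algorithmOverlaps φ lam L u x).Finite ∧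
    ∀ o ∈ algorithmOverlaps φ lam L u x, LeadsToHalfCoincidence φ lam L o

end BalancedPairs

namespace BalancedPairs

section Words

variable {A : Type*}

/-! ### Words and prefixes -/

/-! Both termination conditions amount to one geometric statement: there is a single `D` such that
for every `n`, each window of length `D` in the half-line contains a common vertex of `T` and `T -
λⁿx` (`CommonVertexGap` with `D` independent of `n`).

Balanced pairs: `L` is a left eigenvector, so `∼_L` is equality of lengths, and the irreducible
pairs of stage `n` (counted from 0) are the words of `T` over `T - λⁿx` between consecutive common
vertices. Only finitely many words have bounded length, so finiteness of all stages means bounded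
gaps (`bpaTerminates_of_commonVertexGap`, `BpaTerminates.exists_commonVertexGap`).

Overlaps: since `φ` fixes `u`, inflating the overlaps of `(T, T - y)` gives exactly those of `(T, T
- λy)`. A half-coincidence is a common vertex, and inflation preserves common vertices; finitely
many types give a uniform number of steps, hence uniform gaps. Conversely, with bounded gaps the
offset of an overlap is a difference of two bounded word lengths, and an overlap inflated until its
intersection is longer than `D` contains a common vertex.

Primitivity makes `w` recur with bounded gaps, which settles `n = 0`. This needs `λ > 1`; otherwise
the alphabet has one letter and both algorithms terminate. -/

theorem Substitution.onWord_append (φ : Substitution A) (v w : List A) :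
    φ.onWord (v ++ w) = φ.onWord v ++ φ.onWord w := by
  simp [Substitution.onWord]

theorem Substitution.onWord_singleton (φ : Substitution A) (i : A) :
    φ.onWord [i] = φ.img i := by
  simp [Substitution.onWord]

theorem Substitution.onWord_ne_nil (φ : Substitution A) {v : List A} (hv : v ≠ []) :
    φ.onWord v ≠ [] := by
  obtain ⟨i, v, rfl⟩ := List.exists_cons_of_ne_nil hv
  simp [Substitution.onWord, φ.img_ne_nil]

theorem Substitution.length_le_onWord (φ : Substitution A) (v : List A) :
    v.length ≤ (φ.onWord v).length := by
  induction v with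
  | nil => simp
  | cons i v ih =>
    have h := List.length_pos_iff.2 (φ.img_ne_nil i)
    simp only [Substitution.onWord, List.flatMap_cons, List.length_append, List.length_cons] at *
    omega

theorem Substitution.iter_zero (φ : Substitution A) (v : List A) : φ.iter 0 v = v := rfl

theorem Substitution.iter_succ (φ : Substitution A) (n : ℕ) (v : List A) :
    φ.iter (n + 1) v = φ.onWord (φ.iter n v) :=
  Function.iterate_succ_apply' _ _ _

theorem Substitution.iter_append (φ : Substitution A) (n : ℕ) (v w : List A) :
    φ.iter n (v ++ w) = φ.iter n v ++ φ.iter n w := by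
  induction n with
  | zero => rfl
  | succ n ih => simp only [Substitution.iter_succ, ih, Substitution.onWord_append]

theorem length_pre (u : ℕ → A) (k : ℕ) : (pre u k).length = k := by
  simp [pre]

theorem pre_succ (u : ℕ → A) (k : ℕ) : pre u (k + 1) = pre u k ++ [u k] := by
  simp [pre, List.range_succ]

theorem pre_add (u : ℕ → A) (k m : ℕ) : pre u (k + m) = pre u k ++ pre (shift k u) m := by
  induction m with
  | zero => simp [pre]
  | succ m ih => rw [← add_assoc, pre_succ, ih, pre_succ]; simp [shift, add_comm]

theorem isPrefixOf_pre (u : ℕ → A) (k : ℕ) : IsPrefixOf (pre u k) u := by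
  simp [IsPrefixOf, length_pre]

theorem IsPrefixOf.left {u : ℕ → A} {v w : List A} (h : IsPrefixOf (v ++ w) u) :
    IsPrefixOf v u := by
  unfold IsPrefixOf at *
  rw [List.length_append, pre_add] at h
  exact (List.append_inj h (by rw [length_pre])).1

theorem isPrefixOf_shift_iff {u : ℕ → A} {w v : List A} (hw : IsPrefixOf w u) :
    IsPrefixOf v (shift w.length u) ↔ IsPrefixOf (w ++ v) u := by
  have hw' : pre u w.length = w := hw.symm
  unfold IsPrefixOf
  rw [List.length_append, pre_add, hw', List.append_cancel_left_eq]

theorem Substitution.Fixes.onWord {φ : Substitution A} {u : ℕ → A} (hu : φ.Fixes u)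
    {v : List A} (hv : IsPrefixOf v u) : IsPrefixOf (φ.onWord v) u := by
  rw [hv]; exact hu _

theorem Substitution.Fixes.iter {φ : Substitution A} {u : ℕ → A} (hu : φ.Fixes u)
    {v : List A} (hv : IsPrefixOf v u) (n : ℕ) : IsPrefixOf (φ.iter n v) u := by
  induction n with
  | zero => exact hv
  | succ n ih => rw [Substitution.iter_succ]; exact hu.onWord ih

/-- A letter of `φ(v)` comes from a letter of `v`. -/
theorem Substitution.onWord_split (φ : Substitution A) {v a b : List A} {i : A}
    (h : φ.onWord v = a ++ i :: b) :
    ∃ v₁ j v₂ c d, v = v₁ ++ j :: v₂ ∧ φ.img j = c ++ i :: d ∧ a = φ.onWord v₁ ++ c := by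
  induction v generalizing a with
  | nil => simp [Substitution.onWord] at h
  | cons j v ih =>
    have h' : φ.img j ++ φ.onWord v = a ++ i :: b := by simpa [Substitution.onWord] using h
    rcases List.append_eq_append_iff.1 h' with ⟨c, hc, hc'⟩ | ⟨c, hc, hc'⟩
    · obtain ⟨v₁, k, v₂, e, d, rfl, hk, hce⟩ := ih hc'
      exact ⟨j :: v₁, k, v₂, e, d, rfl, hk, by simp [hc, hce, Substitution.onWord]⟩
    · cases c with
      | nil =>
        obtain ⟨v₁, k, v₂, e, d, rfl, hk, hce⟩ := ih (a := []) (by simpa using hc'.symm)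
        refine ⟨j :: v₁, k, v₂, e, d, rfl, hk, ?_⟩
        simp only [List.append_nil] at hc
        rw [← hc, Substitution.onWord, List.flatMap_cons, List.append_assoc]
        change φ.img j = φ.img j ++ (φ.onWord v₁ ++ e)
        rw [← hce, List.append_nil]
      | cons k c =>
        simp only [List.cons_append, List.cons.injEq] at hc'
        exact ⟨[], j, v, a, c, rfl, by rw [hc, hc'.1], by simp [Substitution.onWord]⟩

end Words

section Length

variable {A : Type*} [DecidableEq A] [Fintype A] {L : A → ℝ}

/-! ### Geometric length -/

theorem wordLength_eq_sum (L : A → ℝ) (v : List A) : wordLength L v = (v.map L).sum := by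
  induction v with
  | nil => simp [wordLength, population, dotProduct]
  | cons i v ih =>
    rw [List.map_cons, List.sum_cons, ← ih]
    simp only [wordLength, population, dotProduct, List.count_cons]
    simp [mul_add, Finset.sum_add_distrib, add_comm]

theorem wordLength_nil (L : A → ℝ) : wordLength L [] = 0 := by simp [wordLength_eq_sum]

theorem wordLength_singleton (L : A → ℝ) (i : A) : wordLength L [i] = L i := by
  simp [wordLength_eq_sum]

theorem wordLength_append (L : A → ℝ) (v w : List A) :
    wordLength L (v ++ w) = wordLength L v + wordLength L w := by
  simp [wordLength_eq_sum]

theorem wordLength_cons (L : A → ℝ) (i : A) (v : List A) :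
    wordLength L (i :: v) = L i + wordLength L v := by
  simp [wordLength_eq_sum]

theorem wordLength_nonneg (hL : ∀ i, 0 < L i) (v : List A) : 0 ≤ wordLength L v := by
  rw [wordLength_eq_sum]
  exact List.sum_nonneg fun x hx => by
    obtain ⟨i, -, rfl⟩ := List.mem_map.1 hx
    exact (hL i).le

theorem wordLength_pos (hL : ∀ i, 0 < L i) {v : List A} (hv : v ≠ []) : 0 < wordLength L v := by
  obtain ⟨i, v, rfl⟩ := List.exists_cons_of_ne_nil hv
  rw [wordLength_cons]
  linarith [hL i, wordLength_nonneg hL v]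

theorem wordLength_pos_iff (hL : ∀ i, 0 < L i) {v : List A} : 0 < wordLength L v ↔ v ≠ [] := by
  refine ⟨fun h => ?_, wordLength_pos hL⟩
  rintro rfl
  simp [wordLength_nil] at h

theorem exists_letter_bounds {A : Type*} [Finite A] [Nonempty A] {L : A → ℝ} (hL : ∀ i, 0 < L i) :
    ∃ m M : ℝ, 0 < m ∧ (∀ i, m ≤ L i) ∧ 0 < M ∧ ∀ i, L i ≤ M := by
  obtain ⟨i, hi⟩ := Finite.exists_min L
  obtain ⟨j, hj⟩ := Finite.exists_max L
  exact ⟨L i, L j, hL i, hi, hL j, hj⟩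

theorem length_mul_le_wordLength {m : ℝ} (hm : ∀ i, m ≤ L i) (v : List A) :
    v.length * m ≤ wordLength L v := by
  induction v with
  | nil => simp [wordLength_nil]
  | cons i v ih =>
    rw [wordLength_cons, List.length_cons]
    push_cast
    linarith [hm i]

theorem finite_wordLength_le [Nonempty A] (hL : ∀ i, 0 < L i) (B : ℝ) :
    {v : List A | wordLength L v ≤ B}.Finite := by
  obtain ⟨m, -, hm, hmL, -⟩ := exists_letter_bounds hL
  refine (List.finite_length_le A ⌊B / m⌋₊).subset fun v hv => ?_
  refine Nat.le_floor ?_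
  rw [le_div_iff₀ hm]
  exact (length_mul_le_wordLength hmL v).trans hv

/-- The left eigenvector equation, on words. -/
theorem wordLength_onWord {φ : Substitution A} {lam : ℝ}
    (h : Matrix.vecMul L φ.transitionMatrix = lam • L) (v : List A) :
    wordLength L (φ.onWord v) = lam * wordLength L v := by
  induction v with
  | nil => simp [Substitution.onWord, wordLength_nil]
  | cons i v ih =>
    have hi : wordLength L (φ.img i) = lam * L i := by
      have := congrFun h i
      simpa [Matrix.vecMul, wordLength, Substitution.transitionMatrix] using this
    have : φ.onWord (i :: v) = φ.img i ++ φ.onWord v := by simp [Substitution.onWord]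
    rw [this, wordLength_append, wordLength_cons, hi, ih]
    ring

theorem wordLength_iter {φ : Substitution A} {lam : ℝ}
    (h : Matrix.vecMul L φ.transitionMatrix = lam • L) (n : ℕ) (v : List A) :
    wordLength L (φ.iter n v) = lam ^ n * wordLength L v := by
  induction n with
  | zero => simp [Substitution.iter_zero]
  | succ n ih => rw [Substitution.iter_succ, wordLength_onWord h, ih]; ring

/-- Both lengths are multiplied by `λⁿ` under `φⁿ`, so equality at `n = 0` gives all the others. -/
theorem isBalanced_iff {φ : Substitution A} {lam : ℝ}
    (h : Matrix.vecMul L φ.transitionMatrix = lam • L) {β : List A × List A} :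
    IsBalanced φ L β ↔ β.1 ≠ [] ∧ β.2 ≠ [] ∧ wordLength L β.1 = wordLength L β.2 := by
  refine and_congr_right fun _ => and_congr_right fun _ => ⟨fun H => H 0, fun H n => ?_⟩
  rw [wordLength_iter h, wordLength_iter h, H]

theorem IsBalanced.wordLength_eq {φ : Substitution A} {β : List A × List A}
    (h : IsBalanced φ L β) : wordLength L β.1 = wordLength L β.2 := h.2.2 0

/-! ### Vertices of the tiling -/

/-- The point `z` is the left endpoint of a tile of the tiling given by `u`. -/
def IsVertex (L : A → ℝ) (u : ℕ → A) (z : ℝ) : Prop := ∃ k, z = wordLength L (pre u k)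

/-- Every interval `[c, c + D]` with `c ≥ 0` contains a common vertex of `T` and `T - y`. -/
def CommonVertexGap (L : A → ℝ) (u : ℕ → A) (y D : ℝ) : Prop :=
  ∀ c : ℝ, 0 ≤ c → ∃ z, c ≤ z ∧ z ≤ c + D ∧ IsVertex L u z ∧ IsVertex L u (z + y)

theorem IsPrefixOf.isVertex {u : ℕ → A} {v : List A} (h : IsPrefixOf v u) :
    IsVertex L u (wordLength L v) := ⟨v.length, congrArg _ h⟩

theorem isVertex_iff {u : ℕ → A} {z : ℝ} :
    IsVertex L u z ↔ ∃ v, IsPrefixOf v u ∧ z = wordLength L v :=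
  ⟨fun ⟨k, hk⟩ => ⟨_, isPrefixOf_pre u k, hk⟩, fun ⟨_, hv, hz⟩ => hz ▸ hv.isVertex⟩

theorem wordLength_pre_succ (L : A → ℝ) (u : ℕ → A) (k : ℕ) :
    wordLength L (pre u (k + 1)) = wordLength L (pre u k) + L (u k) := by
  rw [pre_succ, wordLength_append, wordLength_singleton]

theorem strictMono_wordLength_pre (hL : ∀ i, 0 < L i) (u : ℕ → A) :
    StrictMono fun k => wordLength L (pre u k) :=
  strictMono_nat_of_lt_succ fun k => by
    simp only [wordLength_pre_succ]
    linarith [hL (u k)]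

theorem IsPrefixOf.eq_of_wordLength_eq (hL : ∀ i, 0 < L i) {u : ℕ → A} {v w : List A}
    (hv : IsPrefixOf v u) (hw : IsPrefixOf w u) (h : wordLength L v = wordLength L w) :
    v = w := by
  rw [hv, hw] at h ⊢
  rw [(strictMono_wordLength_pre hL u).injective h]

theorem IsPrefixOf.exists_append (hL : ∀ i, 0 < L i) {u : ℕ → A} {v : List A} {z : ℝ}
    (hv : IsPrefixOf v u) (hz : IsVertex L u z) (h : wordLength L v ≤ z) :
    ∃ r, IsPrefixOf (v ++ r) u ∧ z = wordLength L v + wordLength L r := by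
  obtain ⟨k, rfl⟩ := hz
  have hv' : pre u v.length = v := hv.symm
  have hk : v.length ≤ k := by
    refine (strictMono_wordLength_pre hL u).le_iff_le.1 ?_
    simpa only [hv'] using h
  obtain ⟨m, rfl⟩ := Nat.exists_eq_add_of_le hk
  refine ⟨pre (shift v.length u) m, ?_, ?_⟩
  · have := isPrefixOf_pre u (v.length + m)
    rwa [pre_add, hv'] at this
  · rw [pre_add, hv', wordLength_append]

/-- A vertex strictly inside the stretch occupied by `b` cuts `b`; strictness on both sides makes
both pieces nonempty. -/
theorem IsPrefixOf.exists_split (hL : ∀ i, 0 < L i) {u : ℕ → A} {a b : List A} {z : ℝ}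
    (h : IsPrefixOf (a ++ b) u) (hz : IsVertex L u z) (h₁ : wordLength L a < z)
    (h₂ : z < wordLength L a + wordLength L b) :
    ∃ γ δ, b = γ ++ δ ∧ γ ≠ [] ∧ δ ≠ [] ∧ z = wordLength L a + wordLength L γ := by
  obtain ⟨γ, hγ, hzγ⟩ := h.left.exists_append hL hz h₁.le
  obtain ⟨δ, hδ, hzδ⟩ := hγ.exists_append hL h.isVertex
    (by simp only [wordLength_append]; linarith)
  have hb := h.eq_of_wordLength_eq hL hδ (by rw [hzδ, wordLength_append L (a ++ γ)])
  rw [List.append_assoc, List.append_cancel_left_eq] at hb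
  refine ⟨γ, δ, hb, (wordLength_pos_iff hL).1 (by linarith), (wordLength_pos_iff hL).1 ?_, hzγ⟩
  rw [hb, wordLength_append] at h₂
  linarith

theorem exists_tile_mem [Nonempty A] (hL : ∀ i, 0 < L i) (u : ℕ → A) {c : ℝ} (hc : 0 ≤ c) :
    ∃ k, wordLength L (pre u k) ≤ c ∧ c < wordLength L (pre u (k + 1)) := by
  obtain ⟨m, -, hm, hmL, -⟩ := exists_letter_bounds hL
  have hex : ∃ k, c < wordLength L (pre u k) := by
    obtain ⟨k, hk⟩ := exists_nat_gt (c / m)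
    refine ⟨k, ((div_lt_iff₀ hm).1 hk).trans_le ?_⟩
    simpa [length_pre] using length_mul_le_wordLength hmL (pre u k)
  classical
  obtain ⟨k, hk⟩ : ∃ k, Nat.find hex = k + 1 := by
    refine Nat.exists_eq_succ_of_ne_zero fun h => ?_
    have := Nat.find_spec hex
    rw [h] at this
    simp [pre, wordLength_nil] at this
    linarith
  refine ⟨k, not_lt.1 (Nat.find_min hex (by omega)), ?_⟩
  rw [← hk]
  exact Nat.find_spec hex

theorem IsVertex.mul {φ : Substitution A} {lam : ℝ} {u : ℕ → A} {z : ℝ}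
    (h : Matrix.vecMul L φ.transitionMatrix = lam • L) (hu : φ.Fixes u)
    (hz : IsVertex L u z) : IsVertex L u (lam * z) := by
  obtain ⟨v, hv, rfl⟩ := isVertex_iff.1 hz
  rw [← wordLength_onWord h]
  exact (hu.onWord hv).isVertex

theorem IsVertex.pow_mul {φ : Substitution A} {lam : ℝ} {u : ℕ → A} {z : ℝ}
    (h : Matrix.vecMul L φ.transitionMatrix = lam • L) (hu : φ.Fixes u)
    (hz : IsVertex L u z) (n : ℕ) : IsVertex L u (lam ^ n * z) := by
  induction n with
  | zero => simpa using hz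
  | succ n ih => rw [pow_succ', mul_assoc]; exact ih.mul h hu

theorem lam_pos [Nonempty A] {φ : Substitution A} {lam : ℝ} (hL : ∀ i, 0 < L i)
    (h : Matrix.vecMul L φ.transitionMatrix = lam • L) : 0 < lam := by
  obtain ⟨i⟩ := ‹Nonempty A›
  have := wordLength_onWord h [i]
  rw [φ.onWord_singleton, wordLength_singleton] at this
  have h1 := wordLength_pos hL (φ.img_ne_nil i)
  rw [this] at h1
  exact pos_of_mul_pos_left h1 (hL i).le

/-- Inflation maps common vertices to common vertices. The gap grows with `n`, so this alone handles
only finitely many `n`. -/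
theorem CommonVertexGap.pow_mul {φ : Substitution A} {lam : ℝ} {u : ℕ → A} {y D : ℝ}
    (h : Matrix.vecMul L φ.transitionMatrix = lam • L) (hlam : 0 < lam) (hu : φ.Fixes u)
    (hg : CommonVertexGap L u y D) (n : ℕ) :
    CommonVertexGap L u (lam ^ n * y) (lam ^ n * D) := by
  intro c hc
  have hn : 0 < lam ^ n := pow_pos hlam n
  obtain ⟨z, h₁, h₂, hz, hzy⟩ := hg (c / lam ^ n) (by positivity)
  refine ⟨lam ^ n * z, ?_, ?_, hz.pow_mul h hu n, ?_⟩
  · rw [div_le_iff₀ hn] at h₁; linarith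
  · have := mul_le_mul_of_nonneg_left h₂ hn.le
    rwa [mul_add, mul_div_cancel₀ _ hn.ne'] at this
  · rw [← mul_add]; exact hzy.pow_mul h hu n

theorem CommonVertexGap.mono {u : ℕ → A} {y D D' : ℝ} (hg : CommonVertexGap L u y D)
    (hD : D ≤ D') : CommonVertexGap L u y D' := fun c hc => by
  obtain ⟨z, h₁, h₂, h₃⟩ := hg c hc
  exact ⟨z, h₁, by linarith, h₃⟩

end Length

section Concatenation

variable {A : Type*}

/-! ### Reductions of balanced pairs -/

theorem topWord_append (l l' : List (List A × List A)) :
    topWord (l ++ l') = topWord l ++ topWord l' := by simp [topWord]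

theorem bottomWord_append (l l' : List (List A × List A)) :
    bottomWord (l ++ l') = bottomWord l ++ bottomWord l' := by simp [bottomWord]

theorem topWord_cons (δ : List A × List A) (l : List (List A × List A)) :
    topWord (δ :: l) = δ.1 ++ topWord l := by simp [topWord]

theorem bottomWord_cons (δ : List A × List A) (l : List (List A × List A)) :
    bottomWord (δ :: l) = δ.2 ++ bottomWord l := by simp [bottomWord]

end Concatenation

section Bpa

variable {A : Type*} [DecidableEq A] [Fintype A] {L : A → ℝ} {φ : Substitution A} {lam : ℝ}
  {u : ℕ → A}

theorem wordLength_topWord {l : List (List A × List A)} (hl : ∀ δ ∈ l, IsBalanced φ L δ) :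
    wordLength L (topWord l) = wordLength L (bottomWord l) := by
  induction l with
  | nil => rfl
  | cons δ l ih =>
    rw [topWord_cons, bottomWord_cons, wordLength_append, wordLength_append,
      (hl δ (by simp)).wordLength_eq, ih fun δ' h' => hl δ' (by simp [h'])]

theorem IsBalanced.exists_reduction {β : List A × List A} (hβ : IsBalanced φ L β) :
    ∃ l : List (List A × List A), (∀ δ ∈ l, IsIrreduciblePair φ L δ) ∧
      topWord l = β.1 ∧ bottomWord l = β.2 := by
  induction hn : β.1.length using Nat.strong_induction_on generalizing β with
  | _ n ih =>
    by_cases hirr : IsIrreduciblePair φ L β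
    · exact ⟨[β], by simpa using hirr, by simp [topWord], by simp [bottomWord]⟩
    · obtain ⟨γ, δ, hγ, hδ, h₁, h₂⟩ := not_not.1 fun h => hirr ⟨hβ, h⟩
      have hγl := List.length_pos_iff.2 hγ.1
      have hδl := List.length_pos_iff.2 hδ.1
      rw [h₁, List.length_append] at hn
      obtain ⟨l, hl, hl₁, hl₂⟩ := ih _ (by omega) hγ rfl
      obtain ⟨l', hl', hl₁', hl₂'⟩ := ih _ (by omega) hδ rfl
      refine ⟨l ++ l', fun ε hε => ?_, ?_, ?_⟩
      · exact (List.mem_append.1 hε).elim (hl ε) (hl' ε)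
      · rw [topWord_append, hl₁, hl₁', h₁]
      · rw [bottomWord_append, hl₂, hl₂', h₂]

theorem IsBalanced.onWord (h : Matrix.vecMul L φ.transitionMatrix = lam • L)
    {β : List A × List A} (hβ : IsBalanced φ L β) :
    IsBalanced φ L (φ.onWord β.1, φ.onWord β.2) :=
  (isBalanced_iff h).2 ⟨φ.onWord_ne_nil hβ.1, φ.onWord_ne_nil hβ.2.1, by
    rw [wordLength_onWord h, wordLength_onWord h, hβ.wordLength_eq]⟩

/-- Carries a covering by pairs of one stage to a covering by pairs of the next. -/
theorem exists_reduction_onWord (h : Matrix.vecMul L φ.transitionMatrix = lam • L)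
    {l : List (List A × List A)} (hl : ∀ δ ∈ l, IsBalanced φ L δ) :
    ∃ l' : List (List A × List A),
      (∀ γ ∈ l', ∃ δ ∈ l, γ ∈ reductionPairs φ L (φ.onWord δ.1, φ.onWord δ.2)) ∧
      topWord l' = φ.onWord (topWord l) ∧ bottomWord l' = φ.onWord (bottomWord l) := by
  induction l with
  | nil => exact ⟨[], by simp, rfl, rfl⟩
  | cons δ l ih =>
    obtain ⟨l', h', h₁', h₂'⟩ := ih fun δ' h' => hl δ' (by simp [h'])
    obtain ⟨l₀, h₀, h₁, h₂⟩ := ((hl δ (by simp)).onWord h).exists_reduction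
    refine ⟨l₀ ++ l', fun γ hγ => ?_, ?_, ?_⟩
    · rcases List.mem_append.1 hγ with hγ | hγ
      · exact ⟨δ, by simp, l₀, h₀, h₁, h₂, hγ⟩
      · obtain ⟨ε, hε, H⟩ := h' γ hγ
        exact ⟨ε, by simp [hε], H⟩
    · rw [topWord_append, topWord_cons, φ.onWord_append, h₁, h₁']
    · rw [bottomWord_append, bottomWord_cons, φ.onWord_append, h₂, h₂']

theorem isIrreduciblePair_of_mem_bpaStage {w : List A} {n : ℕ} {β : List A × List A}
    (hβ : β ∈ bpaStage φ L u w n) : IsIrreduciblePair φ L β := by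
  cases n with
  | zero => obtain ⟨l, hl, -, -, hβ⟩ := hβ; exact hl β hβ
  | succ n => obtain ⟨_, _, l, hl, -, -, hβ⟩ := hβ; exact hl β hβ

/-! ### Positions of the balanced pairs -/

/-- The pair `β` occurs in `T` over `T - y`, between two common vertices. -/
def OccursAt (L : A → ℝ) (u : ℕ → A) (y : ℝ) (β : List A × List A) : Prop :=
  ∃ a b, IsPrefixOf (a ++ β.1) u ∧ IsPrefixOf (b ++ β.2) u ∧ wordLength L a + y = wordLength L b

theorem occursAt_of_mem {a b : List A} {y : ℝ} {l : List (List A × List A)}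
    (hl : ∀ δ ∈ l, IsIrreduciblePair φ L δ) (ha : IsPrefixOf (a ++ topWord l) u)
    (hb : IsPrefixOf (b ++ bottomWord l) u) (hy : wordLength L a + y = wordLength L b)
    {β : List A × List A} (hβ : β ∈ l) : OccursAt L u y β := by
  obtain ⟨l₁, l₂, rfl⟩ := List.append_of_mem hβ
  refine ⟨a ++ topWord l₁, b ++ bottomWord l₁, ?_, ?_, ?_⟩
  · rw [topWord_append, topWord_cons] at ha
    exact IsPrefixOf.left (w := topWord l₂) (by simpa using ha)
  · rw [bottomWord_append, bottomWord_cons] at hb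
    exact IsPrefixOf.left (w := bottomWord l₂) (by simpa using hb)
  · rw [wordLength_append, wordLength_append,
      wordLength_topWord fun δ hδ => (hl δ (by simp [hδ])).1]
    linarith

theorem occursAt_of_mem_bpaStage (h : Matrix.vecMul L φ.transitionMatrix = lam • L)
    (hu : φ.Fixes u) {w : List A} (hw : IsPrefixOf w u) {n : ℕ} {β : List A × List A}
    (hβ : β ∈ bpaStage φ L u w n) : OccursAt L u (lam ^ n * wordLength L w) β := by
  induction n generalizing β with
  | zero =>
    obtain ⟨l, hl, h₁, h₂, hβ⟩ := hβ
    rw [isPrefixOf_shift_iff hw] at h₂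
    exact occursAt_of_mem (a := []) hl h₁ h₂ (by simp [wordLength_nil]) hβ
  | succ n ih =>
    obtain ⟨γ, hγ, l, hl, h₁, h₂, hβ⟩ := hβ
    obtain ⟨a, b, ha, hb, hab⟩ := ih hγ
    refine occursAt_of_mem (a := φ.onWord a) (b := φ.onWord b) hl ?_ ?_ ?_ hβ
    · rw [h₁, ← φ.onWord_append]; exact hu.onWord ha
    · rw [h₂, ← φ.onWord_append]; exact hu.onWord hb
    · rw [wordLength_onWord h, wordLength_onWord h, ← hab]; ring

/-- A common vertex strictly inside the pair would split it into two balanced pairs, against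
irreducibility. -/
theorem OccursAt.wordLength_le (hL : ∀ i, 0 < L i)
    (h : Matrix.vecMul L φ.transitionMatrix = lam • L) {y D : ℝ} {β : List A × List A}
    (hβ : OccursAt L u y β) (hirr : IsIrreduciblePair φ L β) (hg : CommonVertexGap L u y D) :
    wordLength L β.1 ≤ D + 1 := by
  obtain ⟨a, b, ha, hb, hab⟩ := hβ
  by_contra! hlt
  have ha0 := wordLength_nonneg hL a
  -- The window starts 1 past the left end so that `z` is strictly interior; any positive amount
  -- would do.
  obtain ⟨z, h₁, h₂, hz, hzy⟩ := hg (wordLength L a + 1) (by linarith)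
  have hβ := hirr.1.wordLength_eq
  obtain ⟨γ, δ, hγδ, hγ, hδ, hzγ⟩ := ha.exists_split hL hz (by linarith) (by linarith)
  obtain ⟨γ', δ', hγδ', hγ', hδ', hzγ'⟩ := hb.exists_split hL hzy (by linarith) (by linarith)
  rw [hγδ, hγδ', wordLength_append, wordLength_append] at hβ
  refine hirr.2 ⟨(γ, γ'), (δ, δ'), (isBalanced_iff h).2 ⟨hγ, hγ', ?_⟩,
    (isBalanced_iff h).2 ⟨hδ, hδ', ?_⟩, hγδ, hγδ'⟩
  · dsimp only; linarith
  · dsimp only; linarith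

/-! ### Bounded gaps and termination of the balanced pair algorithm -/

theorem bpaTerminates_of_commonVertexGap [Nonempty A] (hL : ∀ i, 0 < L i)
    (h : Matrix.vecMul L φ.transitionMatrix = lam • L) (hu : φ.Fixes u) {w : List A}
    (hw : IsPrefixOf w u) {D : ℝ}
    (hg : ∀ n : ℕ, CommonVertexGap L u (lam ^ n * wordLength L w) D) :
    BpaTerminates φ L u w := by
  have hfin := finite_wordLength_le hL (D + 1)
  refine (hfin.prod hfin).subset fun β hβ => ?_
  obtain ⟨n, hn⟩ := Set.mem_iUnion.1 hβ
  have hirr := isIrreduciblePair_of_mem_bpaStage hn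
  have hle := (occursAt_of_mem_bpaStage h hu hw hn).wordLength_le hL h hirr (hg n)
  exact ⟨hle, hirr.1.wordLength_eq.symm.trans_le hle⟩

/-- The reductions reach arbitrarily far. At stage 0 this requires arbitrarily distant common
vertices: without them the reduction of the infinite sequences could stop, and finiteness would say
nothing about gaps. -/
theorem exists_bpaStage_cover (hL : ∀ i, 0 < L i)
    (h : Matrix.vecMul L φ.transitionMatrix = lam • L) (hlam : 0 < lam) (hu : φ.Fixes u)
    {w : List A} (hw : IsPrefixOf w u) {D : ℝ} (hg : CommonVertexGap L u (wordLength L w) D)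
    (n : ℕ) (c : ℝ) :
    ∃ l : List (List A × List A), (∀ δ ∈ l, δ ∈ bpaStage φ L u w n) ∧
      IsPrefixOf (topWord l) u ∧ IsPrefixOf (φ.iter n w ++ bottomWord l) u ∧
      c ≤ wordLength L (topWord l) := by
  induction n generalizing c with
  | zero =>
    -- The 1 keeps `z` positive, so the two words cut off at `z` are nonempty.
    obtain ⟨z, h₁, -, hz, hzx⟩ := hg (max c 1) (by positivity)
    have hz1 : 1 ≤ z := (le_max_right _ _).trans h₁
    obtain ⟨v, hv, hzv⟩ := isVertex_iff.1 hz
    obtain ⟨v', hv', hzv'⟩ := hw.exists_append hL hzx (by linarith)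
    have hbal : IsBalanced φ L (v, v') := (isBalanced_iff h).2
      ⟨(wordLength_pos_iff hL).1 (by linarith), (wordLength_pos_iff hL).1 (by linarith),
        by dsimp only; linarith⟩
    obtain ⟨l, hl, hl₁, hl₂⟩ := hbal.exists_reduction
    dsimp only at hl₁ hl₂
    rw [← hl₁] at hv hzv
    rw [← hl₂] at hv'
    refine ⟨l, fun δ hδ => ⟨l, hl, hv, ?_, hδ⟩, hv, hv', ?_⟩
    · rwa [isPrefixOf_shift_iff hw]
    · rw [← hzv]; exact (le_max_left _ _).trans h₁
  | succ n ih =>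
    obtain ⟨l, hl, h₁, h₂, hc⟩ := ih (c / lam)
    obtain ⟨l', hl', h₁', h₂'⟩ := exists_reduction_onWord h
      fun δ hδ => (isIrreduciblePair_of_mem_bpaStage (hl δ hδ)).1
    refine ⟨l', fun γ hγ => ?_, ?_, ?_, ?_⟩
    · obtain ⟨δ, hδ, H⟩ := hl' γ hγ
      exact ⟨δ, hl δ hδ, H⟩
    · rw [h₁']; exact hu.onWord h₁
    · rw [h₂', φ.iter_succ, ← φ.onWord_append]; exact hu.onWord h₂
    · rw [h₁', wordLength_onWord h]
      rw [div_le_iff₀ hlam] at hc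
      linarith

/-- Drop pairs from the end while the rest still reaches `c`; the last pair kept overshoots by at
most its own length. -/
theorem exists_partial_topWord {D c : ℝ} (hD : 0 ≤ D) (hc : 0 ≤ c)
    {l : List (List A × List A)} (hl : ∀ δ ∈ l, wordLength L δ.1 ≤ D)
    (hcl : c ≤ wordLength L (topWord l)) :
    ∃ l₁ l₂, l = l₁ ++ l₂ ∧ c ≤ wordLength L (topWord l₁) ∧
      wordLength L (topWord l₁) ≤ c + D := by
  induction l using List.reverseRecOn with
  | nil => exact ⟨[], [], rfl, hcl, by simp only [topWord, List.flatMap_nil, wordLength_nil]; linarith⟩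
  | append_singleton l δ ih =>
    by_cases hlt : c ≤ wordLength L (topWord l)
    · obtain ⟨l₁, l₂, rfl, h⟩ := ih (fun δ' h' => hl δ' (by simp [h'])) hlt
      exact ⟨l₁, l₂ ++ [δ], by simp, h⟩
    · refine ⟨l ++ [δ], [], by simp, hcl, ?_⟩
      have : topWord [δ] = δ.1 := by simp [topWord]
      rw [topWord_append, wordLength_append, this]
      linarith [hl δ (by simp)]

theorem BpaTerminates.exists_commonVertexGap (hL : ∀ i, 0 < L i)
    (h : Matrix.vecMul L φ.transitionMatrix = lam • L) (hlam : 0 < lam) (hu : φ.Fixes u)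
    {w : List A} (hw : IsPrefixOf w u) {D₀ : ℝ}
    (hg : CommonVertexGap L u (wordLength L w) D₀) (hbpa : BpaTerminates φ L u w) :
    ∃ D, ∀ n : ℕ, CommonVertexGap L u (lam ^ n * wordLength L w) D := by
  obtain ⟨D, hD⟩ := (hbpa.image fun β => wordLength L β.1).bddAbove
  -- An upper bound of a possibly empty set need not be nonnegative.
  refine ⟨max D 0, fun n c hc => ?_⟩
  obtain ⟨l, hl, h₁, h₂, hcl⟩ := exists_bpaStage_cover hL h hlam hu hw hg n c
  obtain ⟨l₁, l₂, rfl, hc₁, hc₂⟩ := exists_partial_topWord (le_max_right D 0) hc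
    (fun δ hδ => (hD ⟨δ, Set.mem_iUnion.2 ⟨n, hl δ hδ⟩, rfl⟩).trans (le_max_left D 0)) hcl
  refine ⟨_, hc₁, hc₂, ?_, ?_⟩
  · rw [topWord_append] at h₁; exact h₁.left.isVertex
  · rw [bottomWord_append, ← List.append_assoc] at h₂
    have := h₂.left.isVertex (L := L)
    rwa [wordLength_append, wordLength_iter h, ← wordLength_topWord (φ := φ), add_comm] at this
    exact fun δ hδ => (isIrreduciblePair_of_mem_bpaStage (hl δ (by simp [hδ]))).1

end Bpa

section Translate

variable {A : Type*} {L : A → ℝ} {φ : Substitution A} {lam : ℝ}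

/-! ### Inflation and translation -/

theorem isOverlap_iff (hL : ∀ i, 0 < L i) {o : Tile A × Tile A} :
    IsOverlap L o ↔ o.1.pos < o.2.rightEnd L ∧ o.2.pos < o.1.rightEnd L := by
  have h₁ := hL o.1.label
  have h₂ := hL o.2.label
  rw [IsOverlap, Tile.support, Tile.support, interior_Icc, interior_Icc, Set.Ioo_inter_Ioo,
    Set.nonempty_Ioo]
  simp only [sup_lt_iff, lt_inf_iff, Tile.rightEnd]
  constructor
  · rintro ⟨⟨-, h⟩, h', -⟩; exact ⟨h', h⟩
  · rintro ⟨h', h⟩; exact ⟨⟨by linarith, h⟩, h', by linarith⟩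

/-- The translate of a pair of tiles. -/
def translatePair (c : ℝ) (o : Tile A × Tile A) : Tile A × Tile A :=
  (o.1.translate c, o.2.translate c)

theorem layTiles_translate (a c : ℝ) (v : List A) :
    layTiles L (a + c) v = (layTiles L a v).map (Tile.translate c) := by
  induction v generalizing a with
  | nil => rfl
  | cons i v ih =>
    rw [layTiles, layTiles, List.map_cons, ← ih, Tile.translate]
    congr 2
    ring

theorem inflateTile_translate (c : ℝ) (t : Tile A) :
    inflateTile φ lam L (t.translate c) =
      (inflateTile φ lam L t).map (Tile.translate (lam * c)) := by
  rw [inflateTile, inflateTile, ← layTiles_translate, Tile.translate, mul_add]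

theorem IsOverlap.translatePair (hL : ∀ i, 0 < L i) {o : Tile A × Tile A} (h : IsOverlap L o)
    (c : ℝ) : IsOverlap L (translatePair c o) := by
  rw [isOverlap_iff hL] at h ⊢
  simp only [BalancedPairs.translatePair, Tile.rightEnd, Tile.translate] at *
  constructor <;> linarith

theorem IsHalfCoincidence.translatePair {o : Tile A × Tile A} (h : IsHalfCoincidence L o)
    (c : ℝ) : IsHalfCoincidence L (translatePair c o) := by
  simp only [IsHalfCoincidence, BalancedPairs.translatePair, Tile.rightEnd, Tile.translate] at *
  rcases h with h | h
  · left; linarith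
  · right; linarith

/-- Makes the number of steps to a half-coincidence depend only on the type of the overlap. -/
theorem iterate_inflateOverlaps_translate (hL : ∀ i, 0 < L i) (c : ℝ) (n : ℕ)
    {o o' : Tile A × Tile A} (h : o' ∈ (inflateOverlaps φ lam L)^[n] {o}) :
    translatePair (lam ^ n * c) o' ∈ (inflateOverlaps φ lam L)^[n] {translatePair c o} := by
  induction n generalizing o' with
  | zero =>
    obtain rfl : o' = o := h
    simp
  | succ n ih =>
    rw [Function.iterate_succ_apply'] at h ⊢
    obtain ⟨hov, o'', ho'', h₁, h₂⟩ := h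
    refine ⟨hov.translatePair hL _, _, ih ho'', ?_, ?_⟩
    · rw [translatePair, inflateTile_translate, pow_succ', mul_assoc]
      exact List.mem_map_of_mem h₁
    · rw [translatePair, inflateTile_translate, pow_succ', mul_assoc]
      exact List.mem_map_of_mem h₂

theorem iterate_inflateOverlaps_mono {E F : Set (Tile A × Tile A)} (h : E ⊆ F) (n : ℕ) :
    (inflateOverlaps φ lam L)^[n] E ⊆ (inflateOverlaps φ lam L)^[n] F := by
  induction n with
  | zero => exact h
  | succ n ih =>
    rw [Function.iterate_succ_apply', Function.iterate_succ_apply']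
    rintro o ⟨hov, o', ho', H⟩
    exact ⟨hov, o', ih ho', H⟩

theorem exists_mem_iterate_singleton {E : Set (Tile A × Tile A)} {n : ℕ} {o : Tile A × Tile A}
    (h : o ∈ (inflateOverlaps φ lam L)^[n] E) :
    ∃ o' ∈ E, o ∈ (inflateOverlaps φ lam L)^[n] {o'} := by
  induction n generalizing o with
  | zero => exact ⟨o, h, rfl⟩
  | succ n ih =>
    rw [Function.iterate_succ_apply'] at h
    obtain ⟨hov, o', ho', H⟩ := h
    obtain ⟨o'', h'', h'⟩ := ih ho'
    refine ⟨o'', h'', ?_⟩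
    rw [Function.iterate_succ_apply']
    exact ⟨hov, o', h', H⟩

/-- If finitely many types of overlaps lead to a half-coincidence, they do so in a bounded number
of steps. -/
theorem exists_uniform_halfCoincidence (hL : ∀ i, 0 < L i) {E : Set (Tile A × Tile A)}
    (hfin : (overlapType '' E).Finite) (h : ∀ o ∈ E, LeadsToHalfCoincidence φ lam L o) :
    ∃ N : ℕ, ∀ o ∈ E, ∃ n ≤ N, ∃ o' ∈ (inflateOverlaps φ lam L)^[n] {o},
      IsHalfCoincidence L o' := by
  have key : ∀ τ ∈ overlapType '' E, ∃ n : ℕ, ∀ o, overlapType o = τ →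
      ∃ o' ∈ (inflateOverlaps φ lam L)^[n] {o}, IsHalfCoincidence L o' := by
    rintro _ ⟨o, ho, rfl⟩
    obtain ⟨n, o', ho', hhalf⟩ := h o ho
    refine ⟨n, fun p hp => ?_⟩
    obtain ⟨c, rfl⟩ := (overlapType_eq_iff o p).1 hp.symm
    exact ⟨_, iterate_inflateOverlaps_translate hL c n ho', hhalf.translatePair _⟩
  choose! f hf using key
  obtain ⟨N, hN⟩ := (hfin.image f).bddAbove
  exact ⟨N, fun o ho => ⟨_, hN ⟨_, ⟨o, ho, rfl⟩, rfl⟩, hf _ ⟨o, ho, rfl⟩ o rfl⟩⟩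

end Translate

section Tiling

variable {A : Type*} [DecidableEq A] [Fintype A] {L : A → ℝ} {φ : Substitution A} {lam : ℝ}
  {u : ℕ → A}

/-! ### Overlaps of the tiling with its translates -/

theorem mem_layTiles_iff {a : ℝ} {v : List A} {t : Tile A} :
    t ∈ layTiles L a v ↔
      ∃ v₁ v₂, v = v₁ ++ t.label :: v₂ ∧ t.pos = a + wordLength L v₁ := by
  induction v generalizing a with
  | nil => simp [layTiles]
  | cons i v ih =>
    rw [layTiles, List.mem_cons, ih]
    constructor
    · rintro (rfl | ⟨v₁, v₂, rfl, h⟩)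
      · exact ⟨[], v, rfl, by simp [wordLength_nil]⟩
      · exact ⟨i :: v₁, v₂, rfl, by rw [h, wordLength_cons]; ring⟩
    · rintro ⟨v₁, v₂, h, hpos⟩
      cases v₁ with
      | nil =>
        simp only [List.nil_append, List.cons.injEq] at h
        left
        ext
        · simp [hpos, wordLength_nil]
        · exact h.1.symm
      | cons j v₁ =>
        simp only [List.cons_append, List.cons.injEq] at h
        obtain ⟨rfl, rfl⟩ := h
        exact Or.inr ⟨v₁, v₂, rfl, by rw [hpos, wordLength_cons]; ring⟩

theorem mem_tiling_iff {t : Tile A} :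
    t ∈ tiling L u ↔ ∃ v, IsPrefixOf (v ++ [t.label]) u ∧ t.pos = wordLength L v := by
  constructor
  · rintro ⟨k, rfl⟩
    exact ⟨pre u k, by rw [← pre_succ]; exact isPrefixOf_pre u _, rfl⟩
  · rintro ⟨v, hv, hpos⟩
    have hv' := hv
    rw [IsPrefixOf, List.length_append, List.length_singleton, pre_succ] at hv'
    have := List.append_inj' hv' rfl
    refine ⟨v.length, ?_⟩
    ext
    · rw [hpos, ← this.1]
    · simpa using this.2

theorem isVertex_pos {t : Tile A} (ht : t ∈ tiling L u) : IsVertex L u t.pos := by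
  obtain ⟨k, rfl⟩ := ht; exact ⟨k, rfl⟩

theorem isVertex_rightEnd {t : Tile A} (ht : t ∈ tiling L u) : IsVertex L u (t.rightEnd L) := by
  obtain ⟨k, rfl⟩ := ht; exact ⟨k + 1, (wordLength_pre_succ L u k).symm⟩

theorem pos_nonneg (hL : ∀ i, 0 < L i) {t : Tile A} (ht : t ∈ tiling L u) : 0 ≤ t.pos := by
  obtain ⟨k, rfl⟩ := ht; exact wordLength_nonneg hL _

theorem eq_of_mem_tiling (hL : ∀ i, 0 < L i) {s t : Tile A} (hs : s ∈ tiling L u)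
    (ht : t ∈ tiling L u) (h₁ : s.pos < t.rightEnd L) (h₂ : t.pos < s.rightEnd L) : s = t := by
  obtain ⟨j, rfl⟩ := hs
  obtain ⟨k, rfl⟩ := ht
  simp only [Tile.rightEnd, ← wordLength_pre_succ] at h₁ h₂
  have h₁' := (strictMono_wordLength_pre hL u).lt_iff_lt.1 h₁
  have h₂' := (strictMono_wordLength_pre hL u).lt_iff_lt.1 h₂
  obtain rfl : j = k := by omega
  rfl

theorem inflateTile_bounds (hL : ∀ i, 0 < L i)
    (h : Matrix.vecMul L φ.transitionMatrix = lam • L) {s t : Tile A}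
    (ht : t ∈ inflateTile φ lam L s) :
    lam * s.pos ≤ t.pos ∧ t.rightEnd L ≤ lam * s.rightEnd L := by
  obtain ⟨v₁, v₂, hv, hpos⟩ := mem_layTiles_iff.1 ht
  have hlen := wordLength_onWord h [s.label]
  rw [φ.onWord_singleton, wordLength_singleton, hv, wordLength_append, wordLength_cons] at hlen
  have h₁ := wordLength_nonneg hL v₁
  have h₂ := wordLength_nonneg hL v₂
  simp only [Tile.rightEnd]
  constructor <;> linarith

theorem mem_tiling_of_mem_inflateTile (h : Matrix.vecMul L φ.transitionMatrix = lam • L)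
    (hu : φ.Fixes u) {s t : Tile A} (hs : s ∈ tiling L u) (ht : t ∈ inflateTile φ lam L s) :
    t ∈ tiling L u := by
  obtain ⟨v₁, v₂, hv, hpos⟩ := mem_layTiles_iff.1 ht
  obtain ⟨v, hpre, hspos⟩ := mem_tiling_iff.1 hs
  refine mem_tiling_iff.2 ⟨φ.onWord v ++ v₁, IsPrefixOf.left (w := v₂) ?_, ?_⟩
  · have := hu.onWord hpre
    rw [φ.onWord_append, φ.onWord_singleton, hv] at this
    simpa using this
  · rw [hpos, hspos, wordLength_append, wordLength_onWord h]

/-- The image of `u₀ ⋯ u_k` is a prefix of `u` of length at least `k + 1`, so it contains the letter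
at index `k`; the letter it comes from is the parent. -/
theorem exists_mem_inflateTile (h : Matrix.vecMul L φ.transitionMatrix = lam • L)
    (hu : φ.Fixes u) {t : Tile A} (ht : t ∈ tiling L u) :
    ∃ s ∈ tiling L u, t ∈ inflateTile φ lam L s := by
  obtain ⟨k, rfl⟩ := ht
  have hφ := hu (k + 1)
  obtain ⟨m, hm⟩ := Nat.exists_eq_add_of_le
    ((length_pre u (k + 1)).symm.le.trans (φ.length_le_onWord (pre u (k + 1))))
  rw [IsPrefixOf, hm, pre_add u (k + 1) m, pre_succ, List.append_assoc, List.singleton_append] at hφ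
  obtain ⟨v₁, j, v₂, c, d, hv, hj, hc⟩ := φ.onWord_split hφ
  refine ⟨⟨wordLength L v₁, j⟩, mem_tiling_iff.2 ⟨v₁, ?_, rfl⟩, mem_layTiles_iff.2 ⟨c, d, hj, ?_⟩⟩
  · refine IsPrefixOf.left (w := v₂) ?_
    rw [List.append_assoc, List.singleton_append, ← hv, ← pre_succ]
    exact isPrefixOf_pre u _
  · dsimp only
    rw [hc, wordLength_append, wordLength_onWord h]

/-- `T` is its own inflation, and each child lies inside its inflated parent, so parents of
overlapping tiles overlap. -/
theorem inflateOverlaps_initialOverlaps (hL : ∀ i, 0 < L i)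
    (h : Matrix.vecMul L φ.transitionMatrix = lam • L) (hlam : 0 < lam) (hu : φ.Fixes u) (y : ℝ) :
    inflateOverlaps φ lam L (initialOverlaps L u y) = initialOverlaps L u (lam * y) := by
  ext o
  constructor
  · rintro ⟨hov, _, ⟨-, s, hs, t, ht, rfl⟩, h₁, h₂⟩
    dsimp only at h₁ h₂
    rw [inflateTile_translate] at h₂
    obtain ⟨t', ht', h₂⟩ := List.mem_map.1 h₂
    refine ⟨hov, o.1, mem_tiling_of_mem_inflateTile h hu hs h₁, t',
      mem_tiling_of_mem_inflateTile h hu ht ht', ?_⟩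
    rw [← mul_neg, h₂]
  · rintro ⟨hov, s', hs', t', ht', rfl⟩
    obtain ⟨s, hs, h₁⟩ := exists_mem_inflateTile h hu hs'
    obtain ⟨t, ht, h₂⟩ := exists_mem_inflateTile h hu ht'
    refine ⟨hov, (s, t.translate (-y)), ⟨?_, s, hs, t, ht, rfl⟩, h₁, ?_⟩
    · have b₁ := inflateTile_bounds hL h h₁
      have b₂ := inflateTile_bounds hL h h₂
      rw [isOverlap_iff hL] at hov ⊢
      simp only [Tile.rightEnd, Tile.translate] at *
      constructor
      · refine lt_of_mul_lt_mul_left (a := lam) ?_ hlam.le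
        linarith
      · refine lt_of_mul_lt_mul_left (a := lam) ?_ hlam.le
        linarith
    · dsimp only
      rw [inflateTile_translate, mul_neg]
      exact List.mem_map_of_mem h₂

theorem iterate_inflateOverlaps_initialOverlaps (hL : ∀ i, 0 < L i)
    (h : Matrix.vecMul L φ.transitionMatrix = lam • L) (hlam : 0 < lam) (hu : φ.Fixes u) (y : ℝ)
    (n : ℕ) :
    (inflateOverlaps φ lam L)^[n] (initialOverlaps L u y) = initialOverlaps L u (lam ^ n * y) := by
  induction n with
  | zero => simp
  | succ n ih =>
    rw [Function.iterate_succ_apply', ih, inflateOverlaps_initialOverlaps hL h hlam hu, pow_succ',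
      mul_assoc]

theorem mem_algorithmOverlaps_iff (hL : ∀ i, 0 < L i)
    (h : Matrix.vecMul L φ.transitionMatrix = lam • L) (hlam : 0 < lam) (hu : φ.Fixes u) {y : ℝ}
    {o : Tile A × Tile A} :
    o ∈ algorithmOverlaps φ lam L u y ↔ ∃ n : ℕ, o ∈ initialOverlaps L u (lam ^ n * y) := by
  simp only [algorithmOverlaps, Set.mem_iUnion, iterate_inflateOverlaps_initialOverlaps hL h hlam hu]

theorem iterate_inflateOverlaps_bounds (hL : ∀ i, 0 < L i)
    (h : Matrix.vecMul L φ.transitionMatrix = lam • L) (hlam : 0 < lam) {o o' : Tile A × Tile A}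
    {n : ℕ} (ho : o' ∈ (inflateOverlaps φ lam L)^[n] {o}) :
    (lam ^ n * o.1.pos ≤ o'.1.pos ∧ o'.1.rightEnd L ≤ lam ^ n * o.1.rightEnd L) ∧
      (lam ^ n * o.2.pos ≤ o'.2.pos ∧ o'.2.rightEnd L ≤ lam ^ n * o.2.rightEnd L) := by
  induction n generalizing o' with
  | zero =>
    obtain rfl : o' = o := ho
    simp
  | succ n ih =>
    rw [Function.iterate_succ_apply'] at ho
    obtain ⟨-, p, hp, h₁, h₂⟩ := ho
    obtain ⟨⟨p₁, p₂⟩, p₃, p₄⟩ := ih hp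
    obtain ⟨q₁, q₂⟩ := inflateTile_bounds hL h h₁
    obtain ⟨q₃, q₄⟩ := inflateTile_bounds hL h h₂
    have aux : ∀ r, lam ^ (n + 1) * r = lam * (lam ^ n * r) := fun r => by ring
    simp only [aux]
    refine ⟨⟨?_, ?_⟩, ?_, ?_⟩
    · exact (mul_le_mul_of_nonneg_left p₁ hlam.le).trans q₁
    · exact q₂.trans (mul_le_mul_of_nonneg_left p₂ hlam.le)
    · exact (mul_le_mul_of_nonneg_left p₃ hlam.le).trans q₃
    · exact q₄.trans (mul_le_mul_of_nonneg_left p₄ hlam.le)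

/-! ### Common vertices from the overlap algorithm -/

theorem exists_initialOverlap [Nonempty A] (hL : ∀ i, 0 < L i) {y c : ℝ} (hy : 0 ≤ y)
    (hc : 0 ≤ c) :
    ∃ o ∈ initialOverlaps L u y, o.1.pos ≤ c ∧ c < o.1.rightEnd L := by
  obtain ⟨j, hj₁, hj₂⟩ := exists_tile_mem hL u hc
  -- The tile of `T - y` over `c` is the tile of `T` over `c + y`.
  obtain ⟨k, hk₁, hk₂⟩ := exists_tile_mem hL u (add_nonneg hc hy)
  rw [wordLength_pre_succ] at hj₂ hk₂
  refine ⟨(⟨_, u j⟩, Tile.translate (-y) ⟨_, u k⟩), ⟨?_, _, ⟨j, rfl⟩, _, ⟨k, rfl⟩, rfl⟩, hj₁, hj₂⟩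
  rw [isOverlap_iff hL]
  simp only [Tile.rightEnd, Tile.translate]
  constructor <;> linarith

theorem IsHalfCoincidence.exists_commonVertex (hL : ∀ i, 0 < L i) {y : ℝ} {o : Tile A × Tile A}
    (ho : o ∈ initialOverlaps L u y) (h : IsHalfCoincidence L o) :
    ∃ z, o.1.pos ≤ z ∧ z ≤ o.1.rightEnd L ∧ IsVertex L u z ∧ IsVertex L u (z + y) := by
  obtain ⟨-, s, hs, t, ht, rfl⟩ := ho
  have hLs := hL s.label
  rcases h with h | h
  · simp only [Tile.translate] at h
    refine ⟨s.pos, le_rfl, ?_, isVertex_pos hs, ?_⟩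
    · simp only [Tile.rightEnd]; linarith
    · rw [h, neg_add_cancel_right]; exact isVertex_pos ht
  · refine ⟨s.rightEnd L, ?_, le_rfl, isVertex_rightEnd hs, ?_⟩
    · simp only [Tile.rightEnd]; linarith
    · have : s.rightEnd L + y = t.rightEnd L := by
        simp only [Tile.rightEnd, Tile.translate] at h ⊢
        linarith
      rw [this]; exact isVertex_rightEnd ht

/-- An overlap of `(T, T - λⁿy)` yields a common vertex after some `m ≤ N` inflations; the remaining
`N - m` carry that vertex to level `N + n`. The levels up to `N` use the scaled initial gap. -/
theorem OverlapTerminatesWithHalfCoincidences.exists_commonVertexGap [Nonempty A]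
    (hL : ∀ i, 0 < L i) (h : Matrix.vecMul L φ.transitionMatrix = lam • L) (hlam : 0 < lam)
    (hu : φ.Fixes u) {y D₀ : ℝ} (hy : 0 ≤ y) (hg : CommonVertexGap L u y D₀)
    (hov : OverlapTerminatesWithHalfCoincidences φ lam L u y) :
    ∃ D, ∀ n : ℕ, CommonVertexGap L u (lam ^ n * y) D := by
  obtain ⟨N, hN⟩ := exists_uniform_halfCoincidence hL hov.1 hov.2
  obtain ⟨-, M, -, -, hM, hML⟩ := exists_letter_bounds hL
  have late : ∀ n : ℕ, CommonVertexGap L u (lam ^ (N + n) * y) (lam ^ N * (2 * M)) := by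
    intro n c hc
    have hNpos : 0 < lam ^ N := pow_pos hlam N
    -- Moving right by the maximal tile length `M` puts the whole first tile between `c / λ^N` and
    -- `c / λ^N + 2M`.
    obtain ⟨o, ho, hoc₁, hoc₂⟩ := exists_initialOverlap (u := u) hL (y := lam ^ n * y)
      (c := c / lam ^ N + M) (by positivity) (by positivity)
    obtain ⟨m, hm, o', ho', hhalf⟩ :=
      hN o ((mem_algorithmOverlaps_iff hL h hlam hu).2 ⟨n, ho⟩)
    have ho'' := iterate_inflateOverlaps_mono (Set.singleton_subset_iff.2 ho) m ho'
    rw [iterate_inflateOverlaps_initialOverlaps hL h hlam hu] at ho''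
    obtain ⟨z, hz₁, hz₂, hz, hzy⟩ := hhalf.exists_commonVertex hL ho''
    obtain ⟨⟨b₁, b₂⟩, -⟩ := iterate_inflateOverlaps_bounds hL h hlam ho'
    obtain ⟨p, rfl⟩ := Nat.exists_eq_add_of_le' hm
    have hp : 0 < lam ^ p := pow_pos hlam p
    have hcN : lam ^ (p + m) * (c / lam ^ (p + m)) = c := mul_div_cancel₀ _ hNpos.ne'
    have hMo := hML o.1.label
    have e₁ : c ≤ lam ^ (p + m) * o.1.pos := by
      rw [← hcN]
      refine mul_le_mul_of_nonneg_left ?_ hNpos.le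
      simp only [Tile.rightEnd] at hoc₂
      linarith
    have e₂ : lam ^ (p + m) * o.1.rightEnd L ≤ c + lam ^ (p + m) * (2 * M) := by
      have : c + lam ^ (p + m) * (2 * M) = lam ^ (p + m) * (c / lam ^ (p + m) + 2 * M) := by
        rw [mul_add, hcN]
      rw [this]
      refine mul_le_mul_of_nonneg_left ?_ hNpos.le
      simp only [Tile.rightEnd]
      linarith
    have e₃ := mul_le_mul_of_nonneg_left (b₁.trans hz₁) hp.le
    have e₄ := mul_le_mul_of_nonneg_left (hz₂.trans b₂) hp.le
    rw [← mul_assoc, ← pow_add] at e₃ e₄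
    refine ⟨lam ^ p * z, e₁.trans e₃, e₄.trans e₂, hz.pow_mul h hu p, ?_⟩
    have := hzy.pow_mul h hu p
    rw [mul_add] at this
    convert this using 2
    ring
  have early : ∀ n : ℕ, n ≤ N → CommonVertexGap L u (lam ^ n * y)
      -- The sum of absolute values dominates each of its terms, whatever the sign of `D₀`.
      (∑ k ∈ Finset.range (N + 1), |lam ^ k * D₀|) := fun n hn => by
    refine (hg.pow_mul h hlam hu n).mono ((le_abs_self _).trans ?_)
    exact Finset.single_le_sum (f := fun k => |lam ^ k * D₀|) (fun _ _ => abs_nonneg _)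
      (Finset.mem_range.2 (Nat.lt_succ_of_le hn))
  refine ⟨max (∑ k ∈ Finset.range (N + 1), |lam ^ k * D₀|) (lam ^ N * (2 * M)), fun n => ?_⟩
  rcases le_total n N with hn | hn
  · exact (early n hn).mono (le_max_left _ _)
  · obtain ⟨k, rfl⟩ := Nat.exists_eq_add_of_le hn
    exact (late k).mono (le_max_right _ _)

/-! ### Termination of the overlap algorithm from common vertices -/

theorem finite_overlapType [Nonempty A] (hL : ∀ i, 0 < L i)
    (h : Matrix.vecMul L φ.transitionMatrix = lam • L) (hlam : 0 < lam) (hu : φ.Fixes u)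
    {y D : ℝ} (hg : ∀ n : ℕ, CommonVertexGap L u (lam ^ n * y) D) :
    (overlapType '' algorithmOverlaps φ lam L u y).Finite := by
  obtain ⟨-, M, -, -, hM, hML⟩ := exists_letter_bounds hL
  have hfin := finite_wordLength_le hL (D + M)
  have hfin' := (hfin.prod hfin).image fun p => wordLength L p.1 - wordLength L p.2
  refine (Set.finite_univ.prod (Set.finite_univ.prod hfin')).subset ?_
  rintro _ ⟨o, ho, rfl⟩
  obtain ⟨n, hov, s, hs, t, ht, rfl⟩ := (mem_algorithmOverlaps_iff hL h hlam hu).1 ho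
  have hs0 := pos_nonneg hL hs
  obtain ⟨v, hv, hsv⟩ := mem_tiling_iff.1 hs
  obtain ⟨v', hv', htv⟩ := mem_tiling_iff.1 ht
  rw [isOverlap_iff hL] at hov
  simp only [Tile.rightEnd, Tile.translate] at hov
  set x := lam ^ n * y
  -- The window starts at the later left endpoint, so `z` is beyond both and at most `D + M` from
  -- each. The words `r`, `r'` from the two left endpoints to `z` determine the offset.
  obtain ⟨z, h₁, h₂, hz, hzx⟩ := hg n (max s.pos (t.pos - x)) (le_max_of_le_left hs0)
  have h₃ : s.pos ≤ z := (le_max_left _ _).trans h₁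
  have h₄ : t.pos - x ≤ z := (le_max_right _ _).trans h₁
  have hsM := hML s.label
  have htM := hML t.label
  have h₅ : max s.pos (t.pos - x) ≤ s.pos + M := max_le (by linarith) (by linarith)
  have h₆ : max s.pos (t.pos - x) ≤ t.pos - x + M := max_le (by linarith) (by linarith)
  obtain ⟨r, -, hr⟩ := hv.left.exists_append hL hz (by linarith)
  obtain ⟨r', -, hr'⟩ := hv'.left.exists_append hL hzx (by linarith)
  refine ⟨trivial, trivial, (r, r'), ⟨?_, ?_⟩, ?_⟩
  · rw [Set.mem_ofPred_eq]; linarith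
  · rw [Set.mem_ofPred_eq]; linarith
  · simp only [overlapType, Tile.translate]; linarith

/-- The tiles meet in an interval `[a, b]` of positive length. Once `λᵐ(b - a) > D`, its inflation
contains a common vertex `z`, and the two tiles starting at `z` form a half-coincidence descended
from this overlap. -/
theorem leadsToHalfCoincidence_of_commonVertexGap (hL : ∀ i, 0 < L i)
    (h : Matrix.vecMul L φ.transitionMatrix = lam • L) (hlam : 1 < lam) (hu : φ.Fixes u)
    {y D : ℝ} (hg : ∀ n : ℕ, CommonVertexGap L u (lam ^ n * y) D) {o : Tile A × Tile A}
    (ho : o ∈ algorithmOverlaps φ lam L u y) : LeadsToHalfCoincidence φ lam L o := by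
  have hlam0 : 0 < lam := by linarith
  obtain ⟨n, ho⟩ := (mem_algorithmOverlaps_iff hL h hlam0 hu).1 ho
  have ho_mem := ho
  obtain ⟨hov, s, hs, t, ht, rfl⟩ := ho
  have hs0 := pos_nonneg hL hs
  rw [isOverlap_iff hL] at hov
  dsimp only at hov
  set t' := t.translate (-(lam ^ n * y)) with ht'
  have hab : max s.pos t'.pos < min (s.rightEnd L) (t'.rightEnd L) := by
    have h₁ := hL s.label
    have h₂ := hL t'.label
    refine max_lt (lt_min ?_ hov.1) (lt_min hov.2 ?_)
    · simp only [Tile.rightEnd]; linarith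
    · simp only [Tile.rightEnd]; linarith
  set a := max s.pos t'.pos
  set b := min (s.rightEnd L) (t'.rightEnd L)
  obtain ⟨m, hm⟩ := pow_unbounded_of_one_lt (D / (b - a)) hlam
  rw [div_lt_iff₀ (by linarith)] at hm
  have hmpos : 0 < lam ^ m := pow_pos hlam0 m
  obtain ⟨z, h₁, h₂, ⟨j, hj⟩, k, hk⟩ := hg (m + n) (lam ^ m * a)
    (mul_nonneg hmpos.le (le_max_of_le_left hs0))
  have hzb : z < lam ^ m * b := by linarith
  have bounds : ∀ r : ℝ, r ≤ a → lam ^ m * r ≤ z := fun r hr =>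
    (mul_le_mul_of_nonneg_left hr hmpos.le).trans h₁
  have bounds' : ∀ r : ℝ, b ≤ r → z < lam ^ m * r := fun r hr =>
    hzb.trans_le (mul_le_mul_of_nonneg_left hr hmpos.le)
  have hk' : wordLength L (pre u k) + -(lam ^ m * (lam ^ n * y)) = z := by
    rw [← hk]; ring
  have hmem : ((⟨z, u j⟩, ⟨z, u k⟩) : Tile A × Tile A) ∈
      (inflateOverlaps φ lam L)^[m] (initialOverlaps L u (lam ^ n * y)) := by
    rw [iterate_inflateOverlaps_initialOverlaps hL h hlam0 hu]
    refine ⟨?_, ⟨z, u j⟩, ⟨j, by rw [hj]⟩, ⟨_, u k⟩, ⟨k, rfl⟩, ?_⟩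
    · rw [isOverlap_iff hL]
      have h₁ := hL (u j)
      have h₂ := hL (u k)
      simp only [Tile.rightEnd]
      constructor <;> linarith
    · rw [Tile.translate, hk']
  obtain ⟨p, hp, hpm⟩ := exists_mem_iterate_singleton hmem
  refine ⟨m, (⟨z, u j⟩, ⟨z, u k⟩), ?_, Or.inl rfl⟩
  -- It remains to identify the ancestor with the given overlap: in each tiling the two candidate
  -- tiles, inflated `m` times, both cover points just right of `z`, so they coincide.
  convert hpm using 2
  obtain ⟨⟨b₁, b₂⟩, b₃, b₄⟩ := iterate_inflateOverlaps_bounds hL h hlam0 hpm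
  have hj0 := hL (u j)
  have hk0 := hL (u k)
  obtain ⟨-, s₂, hs₂, t₂, ht₂, rfl⟩ := hp
  simp only [Tile.rightEnd] at b₁ b₂ b₃ b₄
  have hss : s = s₂ := by
    refine eq_of_mem_tiling hL hs hs₂ ?_ ?_
    · refine lt_of_mul_lt_mul_left (a := lam ^ m) ?_ hmpos.le
      have := bounds _ (le_max_left s.pos t'.pos)
      simp only [Tile.rightEnd]
      linarith
    · refine lt_of_mul_lt_mul_left (a := lam ^ m) ?_ hmpos.le
      have := bounds' _ (min_le_left (s.rightEnd L) (t'.rightEnd L))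
      linarith
  have htt : t = t₂ := by
    have c₁ := bounds _ (le_max_right s.pos t'.pos)
    have c₂ := bounds' _ (min_le_right (s.rightEnd L) (t'.rightEnd L))
    simp only [ht', Tile.rightEnd, Tile.translate] at c₁ c₂ b₃ b₄
    refine eq_of_mem_tiling hL ht ht₂ ?_ ?_
    · refine lt_of_mul_lt_mul_left (a := lam ^ m) ?_ hmpos.le
      simp only [Tile.rightEnd]
      linarith
    · refine lt_of_mul_lt_mul_left (a := lam ^ m) ?_ hmpos.le
      simp only [Tile.rightEnd]
      linarith
  rw [hss, ht', htt]

end Tiling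

section Recurrence

variable {A : Type*} [DecidableEq A] [Fintype A] {L : A → ℝ} {φ : Substitution A} {lam : ℝ}
  {u : ℕ → A} {one : A}

/-! ### Recurrence of the prefix -/

/-- Since `w` recurs in `u` with bounded gaps, so do the common vertices of `T` and `T - x(w)`. -/
theorem exists_commonVertexGap_of_one_lt (hL : ∀ i, 0 < L i)
    (h : Matrix.vecMul L φ.transitionMatrix = lam • L) (hlam : 1 < lam) (hφ : φ.IsPrimitive)
    (hu0 : u 0 = one) (hu : φ.Fixes u) {w : List A} (hw : IsPrefixOf w u) :
    ∃ D, CommonVertexGap L u (wordLength L w) D := by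
  have : Nonempty A := ⟨one⟩
  have hlam0 : 0 < lam := by linarith
  obtain ⟨-, B, -, -, hB, hBL⟩ := exists_letter_bounds hL
  obtain ⟨m, hm⟩ := hφ
  -- `M` makes `φᴹ(1)` longer than `w`; both are prefixes of `u`, so it begins with `w`.
  obtain ⟨M, hM⟩ := pow_unbounded_of_one_lt (wordLength L w / L one) hlam
  rw [div_lt_iff₀ (hL one)] at hM
  obtain ⟨r, hr⟩ : ∃ r, φ.iter M [one] = w ++ r := by
    have hone : IsPrefixOf [one] u := by simp [IsPrefixOf, pre, hu0]
    have hpre := hu.iter hone M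
    have hlen : wordLength L (φ.iter M [one]) = lam ^ M * L one := by
      rw [wordLength_iter h, wordLength_singleton]
    obtain ⟨r, hr, hr'⟩ := hw.exists_append hL hpre.isVertex (by rw [hlen]; exact hM.le)
    exact ⟨r, hpre.eq_of_wordLength_eq hL hr (by rw [hr', wordLength_append])⟩
  have hpos : 0 < lam ^ (M + m) := pow_pos hlam0 _
  refine ⟨lam ^ (M + m) * (2 * B), fun c hc => ?_⟩
  obtain ⟨k, hk₁, hk₂⟩ := exists_tile_mem hL u (c := c / lam ^ (M + m) + B) (by positivity)
  have hkB := hBL (u k)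
  rw [wordLength_pre_succ] at hk₂
  -- Every `φᵐ(u_k)` contains the letter 1, so every `φᴹ⁺ᵐ(u_k)` contains `w`; the two ends of this
  -- occurrence are the vertices `z` and `z + x`.
  obtain ⟨a, b, hab⟩ := List.append_of_mem (hm m le_rfl (u k) one)
  have hpre : IsPrefixOf (φ.iter m (pre u k) ++ a ++ [one]) u := by
    have := hu.iter (isPrefixOf_pre u (k + 1)) m
    rw [pre_succ, φ.iter_append, hab] at this
    exact IsPrefixOf.left (w := b) (by simpa using this)
  have hlen : wordLength L a ≤ lam ^ m * L (u k) := by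
    rw [← wordLength_singleton L, ← wordLength_iter h, hab, wordLength_append]
    linarith [wordLength_nonneg hL (one :: b)]
  have hpre' := hu.iter hpre M
  rw [φ.iter_append, hr, ← List.append_assoc] at hpre'
  have hv := hpre'.left.isVertex (L := L)
  rw [wordLength_append] at hv
  refine ⟨_, ?_, ?_, hpre'.left.left.isVertex, hv⟩
  all_goals rw [wordLength_iter h, wordLength_append, wordLength_iter h]
  · have h₁ := mul_le_mul_of_nonneg_left
      (show c / lam ^ (M + m) ≤ wordLength L (pre u k) by linarith) hpos.le
    rw [mul_div_cancel₀ _ hpos.ne'] at h₁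
    have h₂ := mul_nonneg (pow_pos hlam0 M).le (wordLength_nonneg hL a)
    rw [mul_add, ← mul_assoc, ← pow_add]
    linarith
  · have h₁ := mul_le_mul_of_nonneg_left
      (show wordLength L (pre u k) + L (u k) ≤ c / lam ^ (M + m) + 2 * B by linarith) hpos.le
    rw [mul_add _ (c / _), mul_div_cancel₀ _ hpos.ne'] at h₁
    refine le_trans ?_ h₁
    rw [pow_add, mul_assoc]
    refine mul_le_mul_of_nonneg_left ?_ (pow_pos hlam0 M).le
    linarith

/-! ### The case without expansion -/

/-- The image of 1 already has the length of 1 from its first letter; without expansion nothing can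
follow. -/
theorem img_eq_of_le_one (hL : ∀ i, 0 < L i)
    (h : Matrix.vecMul L φ.transitionMatrix = lam • L) (hlam : lam ≤ 1)
    (hone : ∃ v, φ.img one = one :: v) : φ.img one = [one] := by
  obtain ⟨v, hv⟩ := hone
  have hlen := wordLength_onWord h [one]
  rw [φ.onWord_singleton, hv, wordLength_cons, wordLength_singleton] at hlen
  by_contra hne
  have hv0 : v ≠ [] := by rintro rfl; exact hne hv
  have h₁ := wordLength_pos hL hv0
  have h₂ := mul_le_mul_of_nonneg_right hlam (hL one).le
  linarith

theorem eq_of_img_eq {A : Type*} {φ : Substitution A} {one : A} (hφ : φ.IsPrimitive) (hone : φ.img one = [one]) (i : A) : i = one := by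
  obtain ⟨m, hm⟩ := hφ
  have hfix : ∀ n, φ.iter n [one] = [one] := fun n => by
    induction n with
    | zero => rfl
    | succ n ih => rw [φ.iter_succ, ih, φ.onWord_singleton, hone]
  have := hm m le_rfl one i
  rwa [hfix, List.mem_singleton] at this

theorem isPrefixOf_of_subsingleton {A : Type*} [Subsingleton A] {u : ℕ → A} (v : List A) : IsPrefixOf v u :=
  List.ext_getElem (length_pre u _).symm fun _ _ _ => Subsingleton.elim _ _

theorem exists_commonVertexGap_of_subsingleton [Nonempty A] [Subsingleton A]
    (hL : ∀ i, 0 < L i) (w : List A) : ∃ D, CommonVertexGap L u (wordLength L w) D := by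
  obtain ⟨-, B, -, -, hB, hBL⟩ := exists_letter_bounds hL
  refine ⟨B, fun c hc => ?_⟩
  obtain ⟨k, hk₁, hk₂⟩ := exists_tile_mem hL u hc
  refine ⟨_, hk₂.le, ?_, ⟨k + 1, rfl⟩, ?_⟩
  · rw [wordLength_pre_succ]
    linarith [hBL (u k)]
  · rw [← wordLength_append]
    exact (isPrefixOf_of_subsingleton _).isVertex

theorem wordLength_eq_length_mul [Subsingleton A] (i : A) (v : List A) :
    wordLength L v = v.length * L i := by
  induction v with
  | nil => simp [wordLength_nil]
  | cons j v ih =>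
    rw [wordLength_cons, ih, Subsingleton.elim j i, List.length_cons]
    push_cast
    ring

/-- With one letter all vertices of both tilings are multiples of one length, so overlapping tiles
coincide. -/
theorem isHalfCoincidence_of_subsingleton [Subsingleton A] (hL : ∀ i, 0 < L i) {w : List A}
    {o : Tile A × Tile A} (ho : o ∈ initialOverlaps L u (wordLength L w)) :
    IsHalfCoincidence L o := by
  obtain ⟨hov, _, ⟨j, rfl⟩, _, ⟨k, rfl⟩, rfl⟩ := ho
  have h0 := hL (u 0)
  rw [isOverlap_iff hL] at hov
  simp only [Tile.rightEnd, Tile.translate, wordLength_eq_length_mul (u 0),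
    Subsingleton.elim (u j) (u 0), Subsingleton.elim (u k) (u 0), length_pre] at hov
  left
  simp only [Tile.translate, wordLength_eq_length_mul (u 0), length_pre]
  have h₁ : ((j + w.length : ℕ) : ℝ) < (k + 1 : ℕ) := by
    push_cast
    refine lt_of_mul_lt_mul_right (a := L (u 0)) ?_ h0.le
    linarith [hov.1]
  have h₂ : (k : ℝ) < (j + w.length + 1 : ℕ) := by
    push_cast
    refine lt_of_mul_lt_mul_right (a := L (u 0)) ?_ h0.le
    linarith [hov.2]
  rw [Nat.cast_lt] at h₁ h₂
  obtain rfl : k = j + w.length := by omega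
  push_cast
  ring

end Recurrence

end BalancedPairs

/-! ### The equivalence, for `λ > 1` and for the one-letter alphabet -/

open BalancedPairs in
theorem proposition3p3 {A : Type*} [Fintype A] [DecidableEq A]
    (φ : Substitution A) (hφ : φ.IsPrimitive)
    (one : A) (hone : ∃ v : List A, φ.img one = one :: v)
    (u : ℕ → A) (hu0 : u 0 = one) (hu : φ.Fixes u)
    (lam : ℝ) (L : A → ℝ) (hL : IsSelfSimilarLength φ lam L)
    (w : List A) (hw : w ≠ []) (hwu : IsPrefixOf w u) :
    OverlapTerminatesWithHalfCoincidences φ lam L u (wordLength L w) ↔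
      BpaTerminates φ L u w := by
  have : Nonempty A := ⟨one⟩
  have hpos := hL.pos
  have h := hL.eigenvector
  have hlam0 := lam_pos hpos h
  have hx := (wordLength_pos hpos hw).le
  rcases lt_or_ge 1 lam with hlam | hlam
  · obtain ⟨D₀, hD₀⟩ := exists_commonVertexGap_of_one_lt hpos h hlam hφ hu0 hu hwu
    constructor
    · intro hov
      obtain ⟨D, hD⟩ := hov.exists_commonVertexGap hpos h hlam0 hu hx hD₀
      exact bpaTerminates_of_commonVertexGap hpos h hu hwu hD
    · intro hbpa
      obtain ⟨D, hD⟩ := hbpa.exists_commonVertexGap hpos h hlam0 hu hwu hD₀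
      exact ⟨finite_overlapType hpos h hlam0 hu hD, fun o ho =>
        leadsToHalfCoincidence_of_commonVertexGap hpos h hlam hu hD ho⟩
  · have himg := img_eq_of_le_one hpos h hlam hone
    have hall := eq_of_img_eq hφ himg
    have : Subsingleton A := ⟨fun i j => (hall i).trans (hall j).symm⟩
    obtain rfl : lam = 1 := by
      have hlen := wordLength_onWord h [one]
      rw [φ.onWord_singleton, himg, wordLength_singleton] at hlen
      exact (mul_eq_right₀ (hpos one).ne').1 hlen.symm
    obtain ⟨D, hD⟩ := exists_commonVertexGap_of_subsingleton (u := u) hpos w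
    have hD' : ∀ n : ℕ, CommonVertexGap L u (1 ^ n * wordLength L w) D := fun n => by
      rwa [one_pow, one_mul]
    -- With `λ = 1` every stage has the same translate `x`, so one gap serves all `n`; each overlap
    -- is itself a half-coincidence, at step 0.
    refine iff_of_true ⟨finite_overlapType hpos h hlam0 hu hD', fun o ho => ?_⟩
      (bpaTerminates_of_commonVertexGap hpos h hu hwu hD')
    obtain ⟨n, hn⟩ := (mem_algorithmOverlaps_iff hpos h hlam0 hu).1 ho
    rw [one_pow, one_mul] at hn
    exact ⟨0, o, rfl, isHalfCoincidence_of_subsingleton hpos hn⟩
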